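/- Let $M$ be a matroid of rank $r$ on a finite ground set $E$, and let $P_M\subset\mathbb R^E$ be its basis polytope, i.e. the convex hull of the points $e_B=\sum_{i\in B}e_i$ for $B$ a basis of $M$. A real-valued function $w$ on the set of bases of $M$ induces a regular subdivision of $P_M$, whose cells are the projections to $P_M$ of the lower faces of the convex hull of $\{(e_B,w(B)) : B \text{ a basis of } M\}\subset\mathbb R^E\times\mathbb R$. (A lower face is a face that has an outward normal vector with negative last coordinate.) The subdivision is a matroid subdivision if each of its cells is the basis polytope of a matroid on $E$, and it is trivial if $P_M$ itself is a cell. The matroid $M$ is called rigid if every regular matroid subdivision of $P_M$ is trivial. The tropical hyperfield $\mathbb T$ is the multiplicative monoid $\mathbb R_{\ge0}$, in which a formal sum of nonzero elements is null if it is empty or its maximum occurs at least twice. A representation of $M$ over $\mathbb T$ is a function $\Delta:\binom Er\to\mathbb T$ with $\Delta(I)\neq0$ if and only if $I$ is a basis of $M$, such that for every $(r-2)$-subset $S$ of $E$ and all distinct $i,j,k,l\in E\setminus S$ the sum $$\Delta(S\cup\{i,j\})\Delta(S\cup\{k,l\})+\Delta(S\cup\{i,k\})\Delta(S\cup\{j,l\})+\Delta(S\cup\{i,l\})\Delta(S\cup\{j,k\})$$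 is null, where zero terms are omitted. Two representations $\Delta,\Delta'$ belong to the same rescaling class if there are $c>0$ and $t\in(\mathbb R_{>0})^E$ such that $\Delta'(I)=c\,\prod_{i\in I}t_i\cdot\Delta(I)$ for all $I\in\binom Er$. The trivial valuation of $M$ is the representation that takes the value $1$ at every basis of $M$ and $0$ at every other $r$-subset of $E$. Proposition. The matroid $M$ is rigid if and only if $M$ has exactly one rescaling class of representations over $\mathbb T$, namely the class of the trivial valuation. -/

import Mathlib

open scoped NNReal

noncomputable section

/-! ### Basis polytopes, regular subdivisions, rigidity -/

/-- The `0/1` vector `e_B = ∑ i ∈ B, e_i`. -/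
def indicatorPoint {α : Type*} (B : Set α) : α → ℝ :=
  B.indicator 1

/-- The basis polytope `P_M`: the convex hull of the points `e_B`, for `B` a basis of `M`. -/
def Matroid.basisPolytope {α : Type*} (M : Matroid α) : Set (α → ℝ) :=
  convexHull ℝ {x | ∃ B : Set α, M.IsBase B ∧ x = indicatorPoint B}

/-- The convex hull of the graph of a height function `w` on the vertices `e_B` of `P_M`.
Only the values of `w` at the bases of `M` matter. -/
def Matroid.liftedPolytope {α : Type*} (M : Matroid α) (w : Set α → ℝ) : Set ((α → ℝ) × ℝ) :=
  convexHull ℝ {p | ∃ B : Set α, M.IsBase B ∧ p = (indicatorPoint B, w B)}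

/-- `F` is a lower face of `Q`: the face of `Q` on which some linear functional of the form
`(x, s) ↦ φ x + s` is minimal. (An outward normal vector is `(-φ, -1)`; every normal vector with
negative last coordinate has this form after scaling.) -/
def IsLowerFace {α : Type*} (Q F : Set ((α → ℝ) × ℝ)) : Prop :=
  ∃ φ : (α → ℝ) →ₗ[ℝ] ℝ, F = {p | p ∈ Q ∧ ∀ q ∈ Q, φ p.1 + p.2 ≤ φ q.1 + q.2}

/-- The regular subdivision of `P_M` induced by the height function `w`, as its set of cells: the
projections of the lower faces of the lifted polytope. -/
def Matroid.regularSubdivision {α : Type*} (M : Matroid α) (w : Set α → ℝ) :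
    Set (Set (α → ℝ)) :=
  {C | ∃ F, IsLowerFace (M.liftedPolytope w) F ∧ C = Prod.fst '' F}

/-- A collection of cells subdividing `P_M` is a matroid subdivision if every cell is the basis
polytope of a matroid on the ground set of `M`. -/
def Matroid.IsMatroidSubdivision {α : Type*} (M : Matroid α) (S : Set (Set (α → ℝ))) : Prop :=
  ∀ C ∈ S, ∃ N : Matroid α, N.E = M.E ∧ C = N.basisPolytope

/-- A polyhedral subdivision of `P_M` is trivial if `P_M` itself is one of its cells (so that the
cells are just `P_M` and its faces). -/
def Matroid.IsTrivialSubdivision {α : Type*} (M : Matroid α) (S : Set (Set (α → ℝ))) : Prop :=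
  M.basisPolytope ∈ S

/-- `M` is rigid if every regular matroid subdivision of its basis polytope is trivial. -/
def Matroid.IsRigid {α : Type*} (M : Matroid α) : Prop :=
  ∀ w : Set α → ℝ, M.IsMatroidSubdivision (M.regularSubdivision w) →
    M.IsTrivialSubdivision (M.regularSubdivision w)

/-! ### The tropical hyperfield and representations over it -/

/-- The nullset of the tropical hyperfield `𝕋`, whose multiplicative monoid is `ℝ≥0`: the formal
sums (multisets) in which the maximum occurs at least twice, together with the zero sum.
Entries `0` do not count in a formal sum, which is why `m = 0` is allowed. -/
def tropicalNullset : Set (Multiset ℝ≥0) :=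
  {s | ∃ m : ℝ≥0, (∀ a ∈ s, a ≤ m) ∧ (m = 0 ∨ 2 ≤ s.count m)}

/-- A (weak) Grassmann-Plücker function over `𝕋` representing `M`, that is, a valuation of `M`.
Since `-1 = 1` in `𝕋`, such a function is a function on the `r`-subsets of the ground set, `r`
being the rank of `M`. It is extended here by `0` to all finite sets, which is what `support`
encodes: the nonzero values are those at the bases of `M`. The three-term Plücker relations are
trivially true if `S` does not have `r - 2` elements, since then all their terms are zero. -/
@[ext]
structure Matroid.TropicalRep {α : Type*} [DecidableEq α] (M : Matroid α) where
  /-- the Plücker coordinates -/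
  val : Finset α → ℝ≥0
  support : ∀ I : Finset α, val I ≠ 0 ↔ M.IsBase (I : Set α)
  plucker : ∀ (S : Finset α) (i j k l : α), i ∉ S → j ∉ S → k ∉ S → l ∉ S →
    i ≠ j → i ≠ k → i ≠ l → j ≠ k → j ≠ l → k ≠ l →
    ({val (insert i (insert j S)) * val (insert k (insert l S)),
      val (insert i (insert k S)) * val (insert j (insert l S)),
      val (insert i (insert l S)) * val (insert j (insert k S))} : Multiset ℝ≥0)
        ∈ tropicalNullset

/-- Rescaling equivalence: the Plücker vectors, which matter only up to a common factor `c ∈ 𝕋ˣ`,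
differ by the action of `t ∈ (𝕋ˣ)^E`. -/
def Matroid.TropicalRep.rescalingSetoid {α : Type*} [DecidableEq α] (M : Matroid α) :
    Setoid M.TropicalRep where
  r Δ Δ' := ∃ (c : ℝ≥0ˣ) (t : α → ℝ≥0ˣ),
    ∀ I : Finset α, Δ'.val I = (c : ℝ≥0) * (∏ i ∈ I, (t i : ℝ≥0)) * Δ.val I
  iseqv :=
    { refl := fun Δ => ⟨1, 1, fun I => by simp⟩
      symm := by
        rintro Δ Δ' ⟨c, t, h⟩
        refine ⟨c⁻¹, fun i => (t i)⁻¹, fun I => ?_⟩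
        have hP : (∏ i ∈ I, (t i : ℝ≥0)) ≠ 0 := Finset.prod_ne_zero_iff.2 fun i _ => (t i).ne_zero
        have hc : (c : ℝ≥0) ≠ 0 := c.ne_zero
        rw [h I]
        simp only [Units.val_inv_eq_inv_val, Finset.prod_inv_distrib]
        field_simp
      trans := by
        rintro Δ Δ' Δ'' ⟨c, t, h⟩ ⟨c', t', h'⟩
        refine ⟨c' * c, fun i => t' i * t i, fun I => ?_⟩
        rw [h' I, h I]
        simp only [Units.val_mul, Finset.prod_mul_distrib]
        ring }

/-- The set `𝒳_M(𝕋)` of rescaling classes of representations of `M` over `𝕋`. -/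
def Matroid.TropicalRescalingClass {α : Type*} [DecidableEq α] (M : Matroid α) : Type _ :=
  Quotient (Matroid.TropicalRep.rescalingSetoid M)

/-- The weak exchange property, for bases which differ in two elements. -/
theorem Matroid.exchange_two {α : Type*} [DecidableEq α] (M : Matroid α) {S : Finset α}
    {i j k l : α} (hi : i ∉ S) (hij : i ≠ j) (hik : i ≠ k) (hil : i ≠ l)
    (h₁ : M.IsBase (insert i (insert j S) : Finset α))
    (h₂ : M.IsBase (insert k (insert l S) : Finset α)) :
    M.IsBase (insert j (insert k S) : Finset α) ∨ M.IsBase (insert j (insert l S) : Finset α) := by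
  obtain ⟨y, ⟨hy, -⟩, hB⟩ := h₁.exchange h₂ (e := i) (by simp [hi, hik, hil])
  have hdel : ((insert i (insert j S) : Finset α) : Set α) \ {i} = insert j (S : Set α) := by
    ext x
    by_cases hx : x = i
    · subst hx; simp [hi, hij]
    · simp [hx]
  rw [hdel] at hB
  have hy' : y = k ∨ y = l ∨ y ∈ S := by simpa using hy
  rcases hy' with rfl | rfl | hyS
  · left
    rw [Finset.insert_comm]
    simpa using hB
  · right
    rw [Finset.insert_comm]
    simpa using hB
  · exfalso
    have hB' : M.IsBase (insert j (S : Set α)) := by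
      rwa [Set.insert_eq_of_mem (Set.mem_insert_of_mem _ (by exact_mod_cast hyS))] at hB
    have hEq := hB'.eq_of_subset_isBase h₁ (by
      intro x hx
      simp only [Finset.coe_insert, Set.mem_insert_iff] at hx ⊢
      exact Or.inr hx)
    have : i ∈ insert j (S : Set α) := by rw [hEq]; simp
    simp [hij, hi] at this

/-- A sum of three terms `0` or `1` of `𝕋` is null unless exactly one term is nonzero. -/
theorem zeroOne_mem_tropicalNullset {x y z : ℝ≥0} (hx : x = 0 ∨ x = 1) (hy : y = 0 ∨ y = 1)
    (hz : z = 0 ∨ z = 1) (hx' : x ≠ 0 → y ≠ 0 ∨ z ≠ 0) (hy' : y ≠ 0 → x ≠ 0 ∨ z ≠ 0)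
    (hz' : z ≠ 0 → x ≠ 0 ∨ y ≠ 0) : ({x, y, z} : Multiset ℝ≥0) ∈ tropicalNullset := by
  rcases hx with rfl | rfl <;> rcases hy with rfl | rfl <;> rcases hz with rfl | rfl <;>
    simp at hx' hy' hz'
  · exact ⟨0, by simp, Or.inl rfl⟩
  all_goals
    refine ⟨1, by simp, Or.inr ?_⟩
    simp [Multiset.insert_eq_cons]

/-- If the first term of a three-term Plücker relation is nonzero for the indicator function of the
bases, then so is one of the other two. -/
theorem Matroid.plucker_two {α : Type*} [DecidableEq α] (M : Matroid α) {S : Finset α}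
    {i j k l : α} (hi : i ∉ S) (hj : j ∉ S) (hk : k ∉ S) (hl : l ∉ S)
    (hij : i ≠ j) (hik : i ≠ k) (hil : i ≠ l) (hjk : j ≠ k) (hjl : j ≠ l) (hkl : k ≠ l)
    (h₁ : M.IsBase (insert i (insert j S) : Finset α))
    (h₂ : M.IsBase (insert k (insert l S) : Finset α)) :
    (M.IsBase (insert i (insert k S) : Finset α) ∧ M.IsBase (insert j (insert l S) : Finset α)) ∨
    (M.IsBase (insert i (insert l S) : Finset α) ∧ M.IsBase (insert j (insert k S) : Finset α)) := by
  have h₁' : M.IsBase (insert j (insert i S) : Finset α) := by rwa [Finset.insert_comm]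
  have h₂' : M.IsBase (insert l (insert k S) : Finset α) := by rwa [Finset.insert_comm]
  have e₁ := M.exchange_two hi hij hik hil h₁ h₂
  have e₂ := M.exchange_two hj hij.symm hjk hjl h₁' h₂
  have e₃ := M.exchange_two hk hkl hik.symm hjk.symm h₂ h₁
  have e₄ := M.exchange_two hl hkl.symm hil.symm hjl.symm h₂' h₁
  rw [Finset.insert_comm l i, Finset.insert_comm l j] at e₃
  rw [Finset.insert_comm k i, Finset.insert_comm k j] at e₄
  tauto

open Classical in
/-- The trivial representation of `M` over `𝕋` (the trivial valuation): the indicator function of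
the bases. -/
def Matroid.trivialTropicalRep {α : Type*} [DecidableEq α] (M : Matroid α) : M.TropicalRep where
  val I := if M.IsBase (I : Set α) then 1 else 0
  support I := by simp
  plucker S i j k l hi hj hk hl hij hik hil hjk hjl hkl := by
    have hterm : ∀ I J : Finset α, ((if M.IsBase (I : Set α) then 1 else 0) *
        (if M.IsBase (J : Set α) then 1 else 0) : ℝ≥0) ≠ 0 ↔
          M.IsBase (I : Set α) ∧ M.IsBase (J : Set α) := by
      intro I J
      split_ifs <;> simp_all
    have hzo : ∀ I J : Finset α, ((if M.IsBase (I : Set α) then 1 else 0) *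
        (if M.IsBase (J : Set α) then 1 else 0) : ℝ≥0) = 0 ∨
        ((if M.IsBase (I : Set α) then 1 else 0) *
        (if M.IsBase (J : Set α) then 1 else 0) : ℝ≥0) = 1 := by
      intro I J
      split_ifs <;> simp
    have p₁ := M.plucker_two hi hj hk hl hij hik hil hjk hjl hkl
    have p₂ := M.plucker_two hi hk hj hl hik hij hil hjk.symm hkl hjl
    have p₃ := M.plucker_two hi hl hj hk hil hij hik hjl.symm hkl.symm hjk
    rw [Finset.insert_comm k j] at p₂
    rw [Finset.insert_comm l k, Finset.insert_comm l j] at p₃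
    refine zeroOne_mem_tropicalNullset (hzo _ _) (hzo _ _) (hzo _ _)
      (fun h => ?_) (fun h => ?_) (fun h => ?_)
    · exact (p₁ ((hterm _ _).1 h).1 ((hterm _ _).1 h).2).imp (hterm _ _).2 (hterm _ _).2
    · exact (p₂ ((hterm _ _).1 h).1 ((hterm _ _).1 h).2).imp (hterm _ _).2 (hterm _ _).2
    · exact (p₃ ((hterm _ _).1 h).1 ((hterm _ _).1 h).2).imp (hterm _ _).2 (hterm _ _).2

/-- The rescaling class of the trivial representation. -/
def Matroid.trivialTropicalClass {α : Type*} [DecidableEq α] (M : Matroid α) :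
    M.TropicalRescalingClass :=
  Quotient.mk (Matroid.TropicalRep.rescalingSetoid M) M.trivialTropicalRep

end

open scoped NNReal

/-! Put `w = -log Δ` on the bases. Rescaling `Δ` by `c` and `t` adds to `w` the restriction of an
affine function to the points `e_B`, so `Δ` lies in the trivial class exactly when `w` is affine on
the bases, that is, when `w` induces the trivial subdivision (`rescaling_trivial_iff`). It remains
to see that the height functions of matroid subdivisions are, on the bases, exactly the functions
`-log Δ`.

Since the points `e_B` are in convex position, a cell is the same thing as the set of bases
minimizing `φ + w` for some linear `φ`, and it is a matroid polytope exactly when this set is the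
set of bases of a matroid.

If `w = -log Δ`, the three-term relations imply the exchange inequality for arbitrary pairs of bases
(`TropicalRep.exchange`). An exchange preserves the sum of the two values of `φ`, so the inequality
turns into basis exchange among the minimizers.

Conversely, a failing three-term relation is an octahedron with a unique lowest diagonal. A suitable
`φ` then selects a cell that contains both ends of this diagonal but none of the vertices that
exchange demands (`IsMatroidSubdivision.octahedron`). -/

/-! ### Faces of convex hulls and cells of regular subdivisions -/

/-- The points of a convex hull minimizing a linear functional are the convex hull of the
minimizing generators. -/
theorem convexHull_setOf_minimizers {E : Type*} [AddCommGroup E] [Module ℝ E] (V : Set E)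
    (g : E →ₗ[ℝ] ℝ) :
    {p | p ∈ convexHull ℝ V ∧ ∀ q ∈ convexHull ℝ V, g p ≤ g q} =
      convexHull ℝ {p | p ∈ V ∧ ∀ q ∈ V, g p ≤ g q} := by
  have hall : ∀ m : ℝ, (∀ q ∈ V, m ≤ g q) → ∀ q ∈ convexHull ℝ V, m ≤ g q := fun m hm =>
    convexHull_min hm (convex_halfSpace_ge g.isLinear m)
  apply Set.Subset.antisymm
  · rintro p ⟨hp, hmin⟩
    set W := {p | p ∈ V ∧ ∀ q ∈ V, g p ≤ g q} with hW
    have hWg : ∀ x ∈ convexHull ℝ W, g p ≤ g x :=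
      fun x hx => hmin x (convexHull_mono (fun y hy => hy.1) hx)
    -- Everything in this union has value at least `g p`, and a proper convex combination involving
    -- a strictly larger value is strictly larger. The union contains `V`, hence also `p`, which
    -- cannot lie in the strict part.
    have hconv : Convex ℝ (convexHull ℝ W ∪ {x | g p < g x}) := by
      rw [convex_iff_forall_pos]
      intro x hx y hy a b ha hb hab
      have hx' : g p ≤ g x := hx.elim (hWg x) fun h => le_of_lt h
      have hy' : g p ≤ g y := hy.elim (hWg y) fun h => le_of_lt h
      have key : g (a • x + b • y) - g p = a * (g x - g p) + b * (g y - g p) := by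
        simp only [map_add, map_smul, smul_eq_mul]
        linear_combination g p * hab
      rcases hx with hx | hx
      · rcases hy with hy | hy
        · exact Or.inl (convex_convexHull ℝ W hx hy ha.le hb.le hab)
        · refine Or.inr (sub_pos.1 ?_ : g p < g (a • x + b • y))
          rw [key]
          exact add_pos_of_nonneg_of_pos (mul_nonneg ha.le (sub_nonneg.2 hx'))
            (mul_pos hb (sub_pos.2 hy))
      · refine Or.inr (sub_pos.1 ?_ : g p < g (a • x + b • y))
        rw [key]
        exact add_pos_of_pos_of_nonneg (mul_pos ha (sub_pos.2 hx))
          (mul_nonneg hb.le (sub_nonneg.2 hy'))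
    have hsub : V ⊆ convexHull ℝ W ∪ {x | g p < g x} := by
      intro v hv
      rcases lt_or_ge (g p) (g v) with h | h
      · exact Or.inr h
      · exact Or.inl (subset_convexHull ℝ W
          ⟨hv, fun q hq => h.trans (hmin q (subset_convexHull ℝ V hq))⟩)
    exact (convexHull_min hsub hconv hp).resolve_right fun h => lt_irrefl (g p) h
  · intro p hp
    refine ⟨convexHull_mono (fun y hy => hy.1) hp, hall _ fun q hq => ?_⟩
    exact convexHull_min (fun x hx => hx.2 q hq) (convex_halfSpace_le g.isLinear (g q)) hp

theorem indicatorPoint_injective {α : Type*} :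
    Function.Injective (indicatorPoint : Set α → α → ℝ) := fun _ _ h =>
  Set.indicator_one_inj ℝ h

/-- The vectors `e_B` are in convex position. -/
theorem indicatorPoint_mem_convexHull {α : Type*} {D : Set (Set α)} {B : Set α} :
    indicatorPoint B ∈ convexHull ℝ {x | ∃ B ∈ D, x = indicatorPoint B} ↔ B ∈ D := by
  refine ⟨fun h => ?_, fun h => subset_convexHull ℝ _ ⟨B, h, rfl⟩⟩
  have hcube : convexHull ℝ {x | ∃ B ∈ D, x = indicatorPoint B} ⊆
      Set.univ.pi fun _ : α => Set.Icc (0 : ℝ) 1 := by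
    refine convexHull_min ?_ (convex_pi fun _ _ => convex_Icc 0 1)
    rintro x ⟨C, -, rfl⟩ a -
    by_cases ha : a ∈ C <;> simp [indicatorPoint, ha]
  -- A vertex of the cube that lies in the hull is extreme in the hull, and extreme points of a hull
  -- are generators.
  have hext : indicatorPoint B ∈ (Set.univ.pi fun _ : α => Set.Icc (0 : ℝ) 1).extremePoints ℝ := by
    rw [extremePoints_pi]
    intro a _
    rw [Set.extremePoints_Icc zero_le_one]
    by_cases ha : a ∈ B <;> simp [indicatorPoint, ha]
  obtain ⟨C, hC, hBC⟩ := extremePoints_convexHull_subset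
    (inter_extremePoints_subset_extremePoints_of_subset hcube ⟨h, hext⟩)
  rwa [indicatorPoint_injective hBC]

/-- The bases of `M` on which `φ + w` is minimal. -/
def Matroid.minimizingBases {α : Type*} (M : Matroid α) (w : Set α → ℝ)
    (φ : (α → ℝ) →ₗ[ℝ] ℝ) : Set (Set α) :=
  {B | M.IsBase B ∧ ∀ C, M.IsBase C →
    φ (indicatorPoint B) + w B ≤ φ (indicatorPoint C) + w C}

/-- The face is spanned by the lifted vertices on it, and the linear projection commutes with taking
hulls. -/
theorem Matroid.fst_image_lowerFace {α : Type*} (M : Matroid α) (w : Set α → ℝ)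
    (φ : (α → ℝ) →ₗ[ℝ] ℝ) :
    Prod.fst '' {p | p ∈ M.liftedPolytope w ∧
        ∀ q ∈ M.liftedPolytope w, φ p.1 + p.2 ≤ φ q.1 + q.2} =
      convexHull ℝ {x | ∃ B ∈ M.minimizingBases w φ, x = indicatorPoint B} := by
  have h := convexHull_setOf_minimizers {p | ∃ B : Set α, M.IsBase B ∧ p = (indicatorPoint B, w B)}
    (φ.coprod LinearMap.id)
  simp only [LinearMap.coprod_apply, LinearMap.id_apply] at h
  rw [Matroid.liftedPolytope, h]
  have himage := (LinearMap.fst ℝ (α → ℝ) ℝ).image_convexHull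
    {p | p ∈ {p | ∃ B : Set α, M.IsBase B ∧ p = (indicatorPoint B, w B)} ∧
      ∀ q ∈ {p | ∃ B : Set α, M.IsBase B ∧ p = (indicatorPoint B, w B)},
        φ p.1 + p.2 ≤ φ q.1 + q.2}
  rw [LinearMap.coe_fst] at himage
  rw [himage]
  congr 1
  ext x
  constructor
  · rintro ⟨_, ⟨⟨B, hB, rfl⟩, hmin⟩, rfl⟩
    exact ⟨B, ⟨hB, fun C hC => hmin _ ⟨C, hC, rfl⟩⟩, rfl⟩
  · rintro ⟨B, ⟨hB, hmin⟩, rfl⟩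
    refine ⟨_, ⟨⟨B, hB, rfl⟩, ?_⟩, rfl⟩
    rintro _ ⟨C, hC, rfl⟩
    exact hmin C hC

/-- The cells of a regular subdivision are the convex hulls of the sets of minimizing bases. -/
theorem Matroid.mem_regularSubdivision {α : Type*} {M : Matroid α} {w : Set α → ℝ}
    {C : Set (α → ℝ)} :
    C ∈ M.regularSubdivision w ↔ ∃ φ : (α → ℝ) →ₗ[ℝ] ℝ,
      C = convexHull ℝ {x | ∃ B ∈ M.minimizingBases w φ, x = indicatorPoint B} := by
  constructor
  · rintro ⟨F, ⟨φ, rfl⟩, rfl⟩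
    exact ⟨φ, M.fst_image_lowerFace w φ⟩
  · rintro ⟨φ, rfl⟩
    exact ⟨_, ⟨φ, rfl⟩, (M.fst_image_lowerFace w φ).symm⟩

/-- The hull of a family of vectors `e_B` is the basis polytope of `N` exactly when the family is
the family of bases of `N`. -/
theorem Matroid.convexHull_eq_basisPolytope_iff {α : Type*} {N : Matroid α} {D : Set (Set α)} :
    convexHull ℝ {x | ∃ B ∈ D, x = indicatorPoint B} = N.basisPolytope ↔
      ∀ B, B ∈ D ↔ N.IsBase B := by
  have hN : N.basisPolytope = convexHull ℝ {x | ∃ B ∈ {B | N.IsBase B}, x = indicatorPoint B} := rfl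
  rw [hN]
  constructor
  · intro h B
    rw [← indicatorPoint_mem_convexHull (D := D), h, indicatorPoint_mem_convexHull]
    rfl
  · intro h
    rw [show D = {B | N.IsBase B} from Set.ext h]

/-- The subdivision is trivial exactly when the height function is affine on the bases. -/
theorem Matroid.isTrivialSubdivision_iff {α : Type*} {M : Matroid α} {w : Set α → ℝ} :
    M.IsTrivialSubdivision (M.regularSubdivision w) ↔
      ∃ (φ : (α → ℝ) →ₗ[ℝ] ℝ) (m : ℝ), ∀ B, M.IsBase B → φ (indicatorPoint B) + w B = m := by
  rw [Matroid.IsTrivialSubdivision, Matroid.mem_regularSubdivision]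
  refine exists_congr fun φ => ?_
  rw [eq_comm, Matroid.convexHull_eq_basisPolytope_iff]
  constructor
  · intro h
    obtain ⟨B₀, hB₀⟩ := M.exists_isBase
    exact ⟨_, fun B hB => le_antisymm (((h B).2 hB).2 B₀ hB₀) (((h B₀).2 hB₀).2 B hB)⟩
  · rintro ⟨m, hm⟩ B
    exact ⟨fun hB => hB.1, fun hB => ⟨hB, fun C hC => by rw [hm B hB, hm C hC]⟩⟩

/-- Convex position lets a cell be read off as a family of bases, so the geometry disappears from
the rest of the argument. -/
theorem Matroid.isMatroidSubdivision_iff {α : Type*} {M : Matroid α} {w : Set α → ℝ} :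
    M.IsMatroidSubdivision (M.regularSubdivision w) ↔
      ∀ φ : (α → ℝ) →ₗ[ℝ] ℝ, ∃ N : Matroid α, N.E = M.E ∧
        ∀ B, B ∈ M.minimizingBases w φ ↔ N.IsBase B := by
  simp only [Matroid.IsMatroidSubdivision, Matroid.mem_regularSubdivision]
  constructor
  · intro h φ
    obtain ⟨N, hE, hN⟩ := h _ ⟨φ, rfl⟩
    exact ⟨N, hE, Matroid.convexHull_eq_basisPolytope_iff.1 hN⟩
  · rintro h _ ⟨φ, rfl⟩
    obtain ⟨N, hE, hN⟩ := h φ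
    exact ⟨N, hE, Matroid.convexHull_eq_basisPolytope_iff.2 hN⟩

/-! ### Linear functionals on the points `e_B` -/

theorem map_indicatorPoint_coe {α : Type*} [DecidableEq α] (φ : (α → ℝ) →ₗ[ℝ] ℝ)
    (I : Finset α) :
    φ (indicatorPoint (I : Set α)) = ∑ i ∈ I, φ (Pi.single i 1) := by
  rw [← map_sum]
  congr 1
  ext x
  by_cases hx : x ∈ I <;> simp [indicatorPoint, Finset.sum_apply, Pi.single_apply, hx]

/-- The type `α` may be infinite, so the functional sums only the coordinates in the finite set `E`.
All bases lie there. -/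
theorem exists_map_indicatorPoint_eq_sum {α : Type*} {E : Set α} (hE : E.Finite) (c : α → ℝ) :
    ∃ φ : (α → ℝ) →ₗ[ℝ] ℝ, ∀ I : Finset α, (I : Set α) ⊆ E →
      φ (indicatorPoint (I : Set α)) = ∑ i ∈ I, c i := by
  classical
  refine ⟨∑ i ∈ hE.toFinset, c i • LinearMap.proj i, fun I hI => ?_⟩
  have hI' : I ⊆ hE.toFinset := fun x hx => hE.mem_toFinset.2 (hI hx)
  simp only [LinearMap.coe_sum, Finset.sum_apply, LinearMap.smul_apply, LinearMap.proj_apply,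
    smul_eq_mul, indicatorPoint, Set.indicator_apply, Finset.mem_coe, Pi.one_apply, mul_ite,
    mul_one, mul_zero]
  rw [Finset.sum_ite_mem, Finset.inter_eq_right.2 hI']

/-! ### Null sums of three terms -/

/-- Two of the three terms attain the maximum, so `y` or `z` does. By symmetry, nullness says that
each term is at most the larger of the other two; `mem_tropicalNullset_of_le_max` is the converse.
-/
theorem le_or_le_of_mem_tropicalNullset {x y z : ℝ≥0}
    (h : ({x, y, z} : Multiset ℝ≥0) ∈ tropicalNullset) : x ≤ y ∨ x ≤ z := by
  obtain ⟨m, hm, rfl | hcount⟩ := h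
  · exact Or.inl ((hm x (by simp)).trans zero_le)
  · have hx : x ≤ m := hm x (by simp)
    by_cases hy : y = m
    · exact Or.inl (hy ▸ hx)
    by_cases hz : z = m
    · exact Or.inr (hz ▸ hx)
    exfalso
    have : ({x, y, z} : Multiset ℝ≥0).count m ≤ 1 := by
      simp only [Multiset.insert_eq_cons, Multiset.count_cons, Multiset.count_singleton,
        Ne.symm hy, Ne.symm hz, if_false]
      split_ifs <;> simp
    omega

theorem mem_tropicalNullset_of_le_max {x y z : ℝ≥0} (hx : x ≤ max y z) (hy : y ≤ max x z)
    (hz : z ≤ max x y) : ({x, y, z} : Multiset ℝ≥0) ∈ tropicalNullset := by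
  have key : (x = y ∧ z ≤ x) ∨ (x = z ∧ y ≤ x) ∨ (y = z ∧ x ≤ y) := by
    rw [le_max_iff] at hx hy hz
    grind
  rcases key with ⟨rfl, h⟩ | ⟨rfl, h⟩ | ⟨rfl, h⟩
  · exact ⟨x, by simp [h], Or.inr (by simp [Multiset.insert_eq_cons])⟩
  · exact ⟨x, by simp [h], Or.inr (by simp [Multiset.insert_eq_cons, Multiset.count_cons])⟩
  · exact ⟨y, by simp [h], Or.inr (by simp [Multiset.insert_eq_cons, Multiset.count_cons])⟩

/-! ### From three-term relations to valuated exchange -/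

/-- The dual exchange property: an element to be added is prescribed. -/
theorem Matroid.IsBase.exists_insert_erase {α : Type*} [DecidableEq α] {M : Matroid α}
    {B B' : Finset α} (hB : M.IsBase (B : Set α)) (hB' : M.IsBase (B' : Set α)) {u : α}
    (hu : u ∈ B \ B') :
    ∃ v ∈ B' \ B, M.IsBase ((insert u (B'.erase v) : Finset α) : Set α) := by
  rw [Finset.mem_sdiff] at hu
  have huE : u ∈ M.E := hB.subset_ground hu.1
  -- In the dual, `u` is removed from the complement of `B'` and replaced by some `v` from the
  -- complement of `B`. Taking complements again gives the claim.
  obtain ⟨v, ⟨⟨hvE, hvB⟩, hv'⟩, hbase⟩ := hB'.compl_isBase_dual.exchange hB.compl_isBase_dual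
    (e := u) ⟨⟨huE, by simpa using hu.2⟩, fun h => h.2 (by simpa using hu.1)⟩
  have hvB' : v ∈ B' := by
    by_contra h
    exact hv' ⟨hvE, by simpa using h⟩
  refine ⟨v, Finset.mem_sdiff.2 ⟨hvB', by simpa using hvB⟩, ?_⟩
  have h := hbase.compl_isBase_of_dual
  convert h using 1
  ext x
  have hx : x ∈ B' → x ∈ M.E := fun h => hB'.subset_ground h
  have huv : u ≠ v := fun h => hu.2 (h ▸ hvB')
  simp only [Finset.coe_insert, Finset.coe_erase, Set.mem_insert_iff, Set.mem_sdiff, Finset.mem_coe,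
    Set.mem_singleton_iff]
  grind

theorem Matroid.TropicalRep.mul_le_or_mul_le {α : Type*} [DecidableEq α] {M : Matroid α}
    (Δ : M.TropicalRep) {S : Finset α} {i j k l : α} (hi : i ∉ S) (hj : j ∉ S) (hk : k ∉ S)
    (hl : l ∉ S) (hij : i ≠ j) (hik : i ≠ k) (hil : i ≠ l) (hjk : j ≠ k) (hjl : j ≠ l)
    (hkl : k ≠ l) :
    Δ.val (insert i (insert j S)) * Δ.val (insert k (insert l S)) ≤
        Δ.val (insert i (insert k S)) * Δ.val (insert j (insert l S)) ∨
      Δ.val (insert i (insert j S)) * Δ.val (insert k (insert l S)) ≤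
        Δ.val (insert i (insert l S)) * Δ.val (insert j (insert k S)) :=
  le_or_le_of_mem_tropicalNullset (Δ.plucker S i j k l hi hj hk hl hij hik hil hjk hjl hkl)

/-- Bases whose difference is a single element are related by one exchange. -/
theorem Matroid.IsBase.exists_eq_insert_erase {α : Type*} [DecidableEq α] {M : Matroid α}
    {B B' : Finset α} (hB : M.IsBase (B : Set α)) (hB' : M.IsBase (B' : Set α)) {u : α}
    (hu : B \ B' = {u}) :
    ∃ v ∈ B' \ B, insert v (B.erase u) = B' ∧ insert u (B'.erase v) = B := by
  have hcard : (B' \ B).card = 1 := by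
    have h := hB'.ncard_eq_ncard_of_isBase hB
    rw [Set.ncard_coe_finset, Set.ncard_coe_finset] at h
    rw [Finset.card_sdiff_comm h, hu, Finset.card_singleton]
  obtain ⟨v, hv⟩ := Finset.card_eq_one.1 hcard
  have h₁ : ∀ x, x ∈ B ∧ x ∉ B' ↔ x = u := fun x => by
    rw [← Finset.mem_sdiff, hu, Finset.mem_singleton]
  have h₂ : ∀ x, x ∈ B' ∧ x ∉ B ↔ x = v := fun x => by
    rw [← Finset.mem_sdiff, hv, Finset.mem_singleton]
  refine ⟨v, by simp [hv], ?_, ?_⟩ <;> ext x <;>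
    simp only [Finset.mem_insert, Finset.mem_erase] <;> grind

/-- The three-term relation on the octahedron around two pairs of elements inside and outside of
a set. -/
theorem Matroid.TropicalRep.mul_le_or_mul_le_of_mem {α : Type*} [DecidableEq α] {M : Matroid α}
    (Δ : M.TropicalRep) {B : Finset α} {u u₀ v₀ v : α} (hu : u ∉ B) (hu₀ : u₀ ∉ B) (huu₀ : u ≠ u₀)
    (hv₀ : v₀ ∈ B) (hv : v ∈ B) (hvv₀ : v₀ ≠ v) :
    Δ.val (insert u ((insert u₀ (B.erase v₀)).erase v)) * Δ.val B ≤
        Δ.val (insert u (B.erase v₀)) * Δ.val (insert u₀ (B.erase v)) ∨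
      Δ.val (insert u ((insert u₀ (B.erase v₀)).erase v)) * Δ.val B ≤
        Δ.val (insert u (B.erase v)) * Δ.val (insert u₀ (B.erase v₀)) := by
  have huv : u ≠ v := fun h => hu (h ▸ hv)
  have huv₀ : u ≠ v₀ := fun h => hu (h ▸ hv₀)
  have hu₀v : u₀ ≠ v := fun h => hu₀ (h ▸ hv)
  have hu₀v₀ : u₀ ≠ v₀ := fun h => hu₀ (h ▸ hv₀)
  have h₁ : insert v ((B.erase v₀).erase v) = B.erase v₀ :=
    Finset.insert_erase (Finset.mem_erase.2 ⟨hvv₀.symm, hv⟩)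
  have h₂ : insert v₀ ((B.erase v₀).erase v) = B.erase v := by
    rw [Finset.erase_right_comm]
    exact Finset.insert_erase (Finset.mem_erase.2 ⟨hvv₀, hv₀⟩)
  have h₃ : insert v (insert v₀ ((B.erase v₀).erase v)) = B := by
    rw [h₂, Finset.insert_erase hv]
  have h := Δ.mul_le_or_mul_le (S := (B.erase v₀).erase v) (i := u) (j := u₀) (k := v) (l := v₀)
    (by simp [hu]) (by simp [hu₀]) (by simp) (by simp) huu₀ huv huv₀ hu₀v hu₀v₀ hvv₀.symm
  rwa [h₃, h₁, h₂, ← Finset.erase_insert_of_ne hu₀v] at h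

/-- The three-term Plücker relations imply the exchange property of valuated matroids. -/
theorem Matroid.TropicalRep.exchange {α : Type*} [DecidableEq α] {M : Matroid α}
    (Δ : M.TropicalRep) {B B' : Finset α} (hB : M.IsBase (B : Set α))
    (hB' : M.IsBase (B' : Set α)) {u : α} (hu : u ∈ B \ B') :
    ∃ v ∈ B' \ B, Δ.val B * Δ.val B' ≤
      Δ.val (insert v (B.erase u)) * Δ.val (insert u (B'.erase v)) := by
  induction hn : (B \ B').card using Nat.strong_induction_on generalizing B' with
  | _ n ih =>
    by_contra! hfail
    have hpos : ∀ {I : Finset α}, M.IsBase (I : Set α) → 0 < Δ.val I := fun h =>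
      pos_iff_ne_zero.2 ((Δ.support _).2 h)
    -- a rescaling making `B` and `B.erase u ∪ {v}` equally large
    have hp : ∀ v, ∃ p : ℝ≥0, 0 < p ∧ (v ∈ B' \ B →
        (Δ.val (insert v (B.erase u)) = 0 ∨ p * Δ.val (insert v (B.erase u)) = Δ.val B) ∧
        Δ.val (insert u (B'.erase v)) < Δ.val B' * p) := by
      intro v
      by_cases h0 : Δ.val (insert v (B.erase u)) = 0
      -- Here no normalization is possible, and `p` only has to be large enough for the strict
      -- inequality.
      · refine ⟨Δ.val (insert u (B'.erase v)) / Δ.val B' + 1, by positivity, fun _ =>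
          ⟨Or.inl h0, ?_⟩⟩
        rw [mul_add, mul_div_cancel₀ _ (hpos hB').ne', mul_one]
        exact lt_add_of_pos_right _ (hpos hB')
      · refine ⟨Δ.val B / Δ.val (insert v (B.erase u)), div_pos (hpos hB) (pos_iff_ne_zero.2 h0),
          fun hv => ⟨Or.inr (div_mul_cancel₀ _ h0), ?_⟩⟩
        rw [← mul_div_assoc, lt_div_iff₀ (pos_iff_ne_zero.2 h0), mul_comm, mul_comm (Δ.val B')]
        exact hfail v hv
    choose p hp0 hp using hp
    -- another element of `B \ B'`
    obtain ⟨u₀, hu₀, hne⟩ : ∃ u₀ ∈ B \ B', u₀ ≠ u := by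
      by_contra! hall
      obtain ⟨v, hv, h₁, h₂⟩ := hB.exists_eq_insert_erase hB'
        (Finset.eq_singleton_iff_unique_mem.2 ⟨hu, hall⟩)
      have := hfail v hv
      rw [h₁, h₂, mul_comm] at this
      exact lt_irrefl _ this
    obtain ⟨v₁, hv₁, hbase₁⟩ := hB.exists_insert_erase hB' hu₀
    -- The best exchange of `u₀` into `B'`, measured after rescaling by `p`. The maximum is positive
    -- because of `v₁`, so the result `B''` is a basis, and it is closer to `B`.
    obtain ⟨v₀, hv₀, hmax⟩ := (B' \ B).exists_max_image
      (fun v => Δ.val (insert u₀ (B'.erase v)) / p v) ⟨v₁, hv₁⟩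
    have hbase : M.IsBase ((insert u₀ (B'.erase v₀) : Finset α) : Set α) := by
      rw [← Δ.support]
      have := (div_pos (hpos hbase₁) (hp0 v₁)).trans_le (hmax v₁ hv₁)
      intro h
      simp [h] at this
    set B'' := insert u₀ (B'.erase v₀) with hB''
    simp only [Finset.mem_sdiff] at hu hu₀ hv₀
    have hcard : (B \ B'').card < n := by
      rw [← hn]
      refine Finset.card_lt_card ⟨fun x hx => ?_, fun h => ?_⟩
      · simp only [hB'', Finset.mem_sdiff, Finset.mem_insert, Finset.mem_erase] at hx ⊢
        grind
      · have := h (Finset.mem_sdiff.2 hu₀)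
        simp [hB''] at this
    obtain ⟨v, hv, hle⟩ := ih _ hcard hbase (by simp [hB'', hu, hne.symm]) rfl
    have hvv : v ∈ B' \ B ∧ v ≠ v₀ := by
      simp only [hB'', Finset.mem_sdiff, Finset.mem_insert, Finset.mem_erase] at hv ⊢
      grind
    obtain ⟨hvBB, hvv₀⟩ := hvv
    obtain ⟨hB0, hlt⟩ := hp v hvBB
    obtain ⟨-, hlt₀⟩ := hp v₀ (Finset.mem_sdiff.2 hv₀)
    have hmaxv := hmax v hvBB
    rw [Finset.mem_sdiff] at hvBB
    have hprod : 0 < Δ.val B * Δ.val B'' := mul_pos (hpos hB) (hpos hbase)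
    rcases hB0 with h0 | hB0
    · rw [h0, zero_mul] at hle
      exact absurd hle hprod.not_ge
    have hlarge : Δ.val B'' * p v ≤ Δ.val (insert u (B''.erase v)) := by
      have hBv : 0 < Δ.val (insert v (B.erase u)) := by
        by_contra! h
        rw [le_zero_iff.1 h, mul_zero] at hB0
        exact (hpos hB).ne hB0
      rw [← hB0] at hle
      refine le_of_mul_le_mul_left ?_ hBv
      calc _ = p v * Δ.val (insert v (B.erase u)) * Δ.val B'' := by ring
        _ ≤ _ := hle
    -- The induction hypothesis makes `B'' + u - v` large. By the three-term relation around `B'`,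
    -- one of the two other diagonals is then large too. The first contradicts the choice of `v₀`
    -- together with the failure at `v₀`, the second the failure at `v`.
    have h3 := Δ.mul_le_or_mul_le_of_mem hu.2 hu₀.2 hne.symm hv₀.1 hvBB.1 hvv₀.symm
    rw [← hB''] at h3
    have hlow : Δ.val B'' * p v * Δ.val B' ≤ Δ.val (insert u (B''.erase v)) * Δ.val B' :=
      mul_le_mul_left hlarge _
    rcases h3 with h3 | h3
    · have h4 : Δ.val (insert u₀ (B'.erase v)) * p v₀ ≤ Δ.val B'' * p v := by
        rwa [div_le_div_iff₀ (hp0 v) (hp0 v₀)] at hmaxv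
      have h5 := hlow.trans h3
      have h6 : Δ.val (insert u (B'.erase v₀)) * (Δ.val (insert u₀ (B'.erase v)) * p v₀) <
          Δ.val B' * p v₀ * (Δ.val B'' * p v) :=
        (mul_le_mul' le_rfl h4).trans_lt
          (mul_lt_mul_of_pos_right hlt₀ (mul_pos (hpos hbase) (hp0 v)))
      have h7 := mul_le_mul_left h5 (p v₀)
      have h8 : Δ.val B'' * p v * Δ.val B' * p v₀ < Δ.val B'' * p v * Δ.val B' * p v₀ :=
        calc _ ≤ _ := h7
          _ = Δ.val (insert u (B'.erase v₀)) * (Δ.val (insert u₀ (B'.erase v)) * p v₀) := by ring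
          _ < _ := h6
          _ = _ := by ring
      exact lt_irrefl _ h8
    · have h5 := hlow.trans h3
      have h6 : Δ.val (insert u (B'.erase v)) * Δ.val B'' < Δ.val B' * p v * Δ.val B'' :=
        mul_lt_mul_of_pos_right hlt (hpos hbase)
      refine absurd (h5.trans_lt h6) ?_
      rw [show Δ.val B' * p v * Δ.val B'' = Δ.val B'' * p v * Δ.val B' by ring]
      exact lt_irrefl _

/-! ### From representations to matroid subdivisions -/

/-- The height function given by the negative logarithms of a tropical representation. -/
noncomputable def Matroid.TropicalRep.height {α : Type*} [DecidableEq α] {M : Matroid α}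
    (Δ : M.TropicalRep) (B : Set α) : ℝ :=
  -- The default `0` is harmless, since bases of a finite matroid are finite.
  open Classical in if h : B.Finite then -Real.log (Δ.val h.toFinset) else 0

theorem Matroid.TropicalRep.height_coe {α : Type*} [DecidableEq α] {M : Matroid α}
    (Δ : M.TropicalRep) (I : Finset α) : Δ.height (I : Set α) = -Real.log (Δ.val I) := by
  simp [Matroid.TropicalRep.height]

theorem Matroid.TropicalRep.coe_val_pos {α : Type*} [DecidableEq α] {M : Matroid α}
    (Δ : M.TropicalRep) {I : Finset α} (hI : M.IsBase (I : Set α)) : 0 < (Δ.val I : ℝ) :=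
  NNReal.coe_pos.2 (pos_iff_ne_zero.2 ((Δ.support I).2 hI))

theorem Matroid.TropicalRep.isMatroidSubdivision {α : Type*} [DecidableEq α] {M : Matroid α}
    [M.Finite] (Δ : M.TropicalRep) :
    M.IsMatroidSubdivision (M.regularSubdivision Δ.height) := by
  rw [Matroid.isMatroidSubdivision_iff]
  intro φ
  have hne : ∃ B, B ∈ M.minimizingBases Δ.height φ := by
    have hfin : {B | M.IsBase B}.Finite :=
      M.ground_finite.finite_subsets.subset fun B hB => hB.subset_ground
    obtain ⟨B, hB, hmin⟩ := hfin.exists_minimalFor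
      (fun B => φ (indicatorPoint B) + Δ.height B) _ M.exists_isBase
    exact ⟨B, hB, fun C hC => (le_total _ _).elim id fun h => hmin hC h⟩
  have hexch : Matroid.ExchangeProperty (· ∈ M.minimizingBases Δ.height φ) := by
    intro X Y hX hY u hu
    lift X to Finset α using M.ground_finite.subset hX.1.subset_ground
    lift Y to Finset α using M.ground_finite.subset hY.1.subset_ground
    obtain ⟨v, hv, hle⟩ := Δ.exchange hX.1 hY.1 (u := u) (by simpa using hu)
    have huv : u ∈ X ∧ u ∉ Y ∧ v ∈ Y ∧ v ∉ X := by
      simp only [Finset.mem_sdiff, Set.mem_sdiff, Finset.mem_coe] at hu hv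
      exact ⟨hu.1, hu.2, hv.1, hv.2⟩
    obtain ⟨huX, huY, hvY, hvX⟩ := huv
    have hpos : 0 < Δ.val X * Δ.val Y :=
      mul_pos (pos_iff_ne_zero.2 ((Δ.support _).2 hX.1)) (pos_iff_ne_zero.2 ((Δ.support _).2 hY.1))
    have hpos' := hpos.trans_le hle
    set X' := insert v (X.erase u) with hX'
    set Y' := insert u (Y.erase v) with hY'
    have hbX : M.IsBase (X' : Set α) := (Δ.support _).1 (left_ne_zero_of_mul hpos'.ne')
    have hbY : M.IsBase (Y' : Set α) := (Δ.support _).1 (right_ne_zero_of_mul hpos'.ne')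
    -- The sum of `φ + w` over the pair does not increase, while both old values were minimal. Hence
    -- the new bases are minimal as well.
    have hheight : Δ.height X' + Δ.height Y' ≤ Δ.height X + Δ.height Y := by
      simp only [Δ.height_coe]
      have h := Real.log_le_log (by exact_mod_cast hpos) (NNReal.coe_le_coe.2 hle)
      rw [NNReal.coe_mul, NNReal.coe_mul,
        Real.log_mul (Δ.coe_val_pos hX.1).ne' (Δ.coe_val_pos hY.1).ne',
        Real.log_mul (Δ.coe_val_pos hbX).ne' (Δ.coe_val_pos hbY).ne'] at h
      linarith
    have hφ : φ (indicatorPoint X') + φ (indicatorPoint Y') =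
        φ (indicatorPoint X) + φ (indicatorPoint Y) := by
      simp only [map_indicatorPoint_coe]
      rw [hX', hY', Finset.sum_insert (by simp [hvX]), Finset.sum_insert (by simp [huY]),
        ← Finset.add_sum_erase X _ huX, ← Finset.add_sum_erase Y _ hvY]
      ring
    refine ⟨v, by simpa using hv, ?_⟩
    have hcoe : insert v ((X : Set α) \ {u}) = (X' : Set α) := by simp [hX']
    rw [hcoe]
    refine ⟨hbX, fun C hC => le_trans ?_ (hX.2 C hC)⟩
    have := hY.2 _ hbY
    linarith
  exact ⟨Matroid.ofIsBaseOfFinite M.ground_finite (· ∈ M.minimizingBases Δ.height φ) hne hexch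
    fun B hB => hB.1.subset_ground, rfl, fun B => Iff.rfl⟩

/-- A representation is a rescaling of the trivial one exactly when its heights are affine. -/
theorem Matroid.TropicalRep.rescaling_trivial_iff {α : Type*} [DecidableEq α] {M : Matroid α}
    [M.Finite] (Δ : M.TropicalRep) :
    (Matroid.TropicalRep.rescalingSetoid M).r M.trivialTropicalRep Δ ↔
      M.IsTrivialSubdivision (M.regularSubdivision Δ.height) := by
  rw [Matroid.isTrivialSubdivision_iff]
  have htriv : ∀ {I : Finset α}, M.IsBase (I : Set α) → M.trivialTropicalRep.val I = 1 :=
    fun h => if_pos h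
  constructor
  · rintro ⟨c, t, h⟩
    obtain ⟨φ, hφ⟩ := exists_map_indicatorPoint_eq_sum M.ground_finite
      fun i => Real.log (t i : ℝ≥0)
    refine ⟨φ, -Real.log (c : ℝ≥0), fun B hB => ?_⟩
    lift B to Finset α using M.ground_finite.subset hB.subset_ground
    have ht : ∀ i ∈ B, ((t i : ℝ≥0) : ℝ) ≠ 0 := fun i _ => NNReal.coe_ne_zero.2 (t i).ne_zero
    rw [hφ B hB.subset_ground, Δ.height_coe, h B, htriv hB, mul_one, NNReal.coe_mul,
      NNReal.coe_prod, Real.log_mul (NNReal.coe_ne_zero.2 c.ne_zero) (Finset.prod_ne_zero_iff.2 ht),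
      Real.log_prod ht]
    ring
  · rintro ⟨φ, m, h⟩
    have hexp : ∀ x : ℝ, Real.toNNReal (Real.exp x) ≠ 0 := fun x => by
      simp [Real.exp_pos]
    -- Exponentiating `log Δ(I) = φ(e_I) - m` yields these scalars.
    refine ⟨Units.mk0 _ (hexp (-m)), fun i => Units.mk0 _ (hexp (φ (Pi.single i 1))), fun I => ?_⟩
    by_cases hI : M.IsBase (I : Set α)
    · have hpos := Δ.coe_val_pos hI
      have hm := h _ hI
      rw [Δ.height_coe] at hm
      rw [htriv hI, mul_one]
      apply NNReal.coe_injective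
      simp only [Units.val_mk0, NNReal.coe_mul, NNReal.coe_prod, Real.coe_toNNReal _ (Real.exp_pos _).le]
      rw [← Real.exp_sum, ← map_indicatorPoint_coe, ← Real.exp_add, ← Real.exp_log hpos]
      congr 1
      linarith
    · have h₁ : Δ.val I = 0 := by_contra fun h => hI ((Δ.support I).1 h)
      have h₂ : M.trivialTropicalRep.val I = 0 := if_neg hI
      rw [h₁, h₂, mul_zero]

/-! ### From matroid subdivisions to representations -/

/-- If the octahedron spanned by `i, j, k, l` over `S` has a unique lowest diagonal, then some cell
of the subdivision violates basis exchange. -/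
theorem Matroid.IsMatroidSubdivision.octahedron {α : Type*} [DecidableEq α] {M : Matroid α}
    [M.Finite] {w : Set α → ℝ} (hw : M.IsMatroidSubdivision (M.regularSubdivision w))
    {S : Finset α} {i j k l : α} (hi : i ∉ S) (hj : j ∉ S) (hk : k ∉ S)
    (hl : l ∉ S) (hij : i ≠ j) (hik : i ≠ k) (hil : i ≠ l) (hjk : j ≠ k) (hjl : j ≠ l)
    (hkl : k ≠ l) (h₁ : M.IsBase (insert i (insert j S) : Finset α))
    (h₂ : M.IsBase (insert k (insert l S) : Finset α)) :
    (M.IsBase (insert i (insert k S) : Finset α) ∧ M.IsBase (insert j (insert l S) : Finset α) ∧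
      w (insert i (insert k S) : Finset α) + w (insert j (insert l S) : Finset α) ≤
        w (insert i (insert j S) : Finset α) + w (insert k (insert l S) : Finset α)) ∨
    (M.IsBase (insert i (insert l S) : Finset α) ∧ M.IsBase (insert j (insert k S) : Finset α) ∧
      w (insert i (insert l S) : Finset α) + w (insert j (insert k S) : Finset α) ≤
        w (insert i (insert j S) : Finset α) + w (insert k (insert l S) : Finset α)) := by
  classical
  by_contra! hcon
  obtain ⟨hcon₁, hcon₂⟩ := hcon
  -- replace the heights of non-bases by a large number
  obtain ⟨W, hWb, hW₁, hW₂⟩ : ∃ W : Finset α → ℝ,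
      (∀ I : Finset α, M.IsBase (I : Set α) → W I = w (I : Set α)) ∧
      w (insert i (insert j S) : Finset α) + w (insert k (insert l S) : Finset α) <
        W (insert i (insert k S)) + W (insert j (insert l S)) ∧
      w (insert i (insert j S) : Finset α) + w (insert k (insert l S) : Finset α) <
        W (insert i (insert l S)) + W (insert j (insert k S)) := by
    generalize hp : w (insert i (insert j S) : Finset α) + w (insert k (insert l S) : Finset α) = p
      at hcon₁ hcon₂
    obtain ⟨H, hH⟩ : ∃ H : ℝ, ∀ a ∈ ({0, w (insert i (insert k S) : Finset α),
        w (insert j (insert l S) : Finset α), w (insert i (insert l S) : Finset α),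
        w (insert j (insert k S) : Finset α)} : Finset ℝ), p < H + a ∧ p < H + H := by
      obtain ⟨m, hm⟩ := Finset.bddBelow ({0, w (insert i (insert k S) : Finset α),
        w (insert j (insert l S) : Finset α), w (insert i (insert l S) : Finset α),
        w (insert j (insert k S) : Finset α)} : Finset ℝ)
      refine ⟨|p| + |m| + 1, fun a ha => ?_⟩
      have := hm (Finset.mem_coe.2 ha)
      have := neg_abs_le m
      have := le_abs_self p
      have := abs_nonneg p
      have := abs_nonneg m
      exact ⟨by linarith, by linarith⟩
    simp only [Finset.mem_insert, Finset.mem_singleton, forall_eq_or_imp, forall_eq] at hH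
    obtain ⟨⟨-, hHH⟩, ⟨ha, -⟩, ⟨hb, -⟩, ⟨hc, -⟩, ⟨hd, -⟩⟩ := hH
    refine ⟨fun I : Finset α => if M.IsBase (I : Set α) then w (I : Set α) else H, fun I hI => if_pos hI, ?_, ?_⟩
    · by_cases h : M.IsBase (insert i (insert k S) : Finset α) <;>
        by_cases h' : M.IsBase (insert j (insert l S) : Finset α) <;>
        simp only [h, h', if_true, if_false]
      · exact hcon₁ h h'
      all_goals linarith
    · by_cases h : M.IsBase (insert i (insert l S) : Finset α) <;>
        by_cases h' : M.IsBase (insert j (insert k S) : Finset α) <;>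
        simp only [h, h', if_true, if_false]
      · exact hcon₂ h h'
      all_goals linarith
  -- With these `a` and `b`, the function `f + W` vanishes at `ij`, `kl`, `ik` and `il`. At `jl` and
  -- `jk` it equals the excess of the respective diagonal over the diagonal `ij`, `kl`, hence is
  -- positive.
  set a : ℝ := (W (insert k (insert l S)) - W (insert i (insert l S)) - W (insert i (insert k S))) / 2
    with ha
  set b : ℝ := -a - W (insert i (insert k S)) with hb
  have hWij := hWb _ h₁
  have hWkl := hWb _ h₂
  obtain ⟨f, hf⟩ : ∃ f : α → ℝ, f = fun x =>
    if x = i then a else if x = j then -W (insert i (insert j S)) - a else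
      if x = k then b else if x = l then -W (insert k (insert l S)) - b else 0 := ⟨_, rfl⟩
  -- On bases, `g` sums to `-|S|` at the vertices of the octahedron and to at least `1 - |S|`
  -- elsewhere. A large multiple `K` of it pushes the other bases up to or above the minimum; ties
  -- there do no harm.
  obtain ⟨g, hg⟩ : ∃ g : α → ℝ, g = fun x =>
    if x ∈ S then -1 else if x ∈ ({i, j, k, l} : Finset α) then 0 else 1 := ⟨_, rfl⟩
  have hfi : f i = a := by simp [hf]
  have hfj : f j = -W (insert i (insert j S)) - a := by simp [hf, hij.symm]
  have hfk : f k = b := by simp [hf, hik.symm, hjk.symm]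
  have hfl : f l = -W (insert k (insert l S)) - b := by simp [hf, hil.symm, hjl.symm, hkl.symm]
  have hfS : ∑ x ∈ S, f x = 0 := Finset.sum_eq_zero fun x hx => by
    rw [hf]; dsimp only
    rw [if_neg (ne_of_mem_of_not_mem hx hi), if_neg (ne_of_mem_of_not_mem hx hj),
      if_neg (ne_of_mem_of_not_mem hx hk), if_neg (ne_of_mem_of_not_mem hx hl)]
  have hgS : ∀ x ∈ S, g x = -1 := fun x hx => by simp [hg, hx]
  have hnotS : ∀ x ∈ ({i, j, k, l} : Finset α), x ∉ S := by
    simp only [Finset.mem_insert, Finset.mem_singleton]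
    rintro x (rfl | rfl | rfl | rfl) <;> assumption
  have hgT : ∀ x ∈ ({i, j, k, l} : Finset α), g x = 0 := fun x hx => by
    rw [hg]; dsimp only; rw [if_neg (hnotS x hx), if_pos hx]
  have hgU : ∀ x, x ∉ S → x ∉ ({i, j, k, l} : Finset α) → g x = 1 := fun x hx hx' => by
    rw [hg]; dsimp only; rw [if_neg hx, if_neg hx']
  have hgsum : ∑ x ∈ S, g x = -(S.card : ℝ) := by
    rw [Finset.sum_congr rfl hgS]; simp
  obtain ⟨φ₀, hφ₀⟩ := exists_map_indicatorPoint_eq_sum M.ground_finite f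
  obtain ⟨φ₁, hφ₁⟩ := exists_map_indicatorPoint_eq_sum M.ground_finite g
  obtain ⟨K, hKpos, hK⟩ :
      ∃ K : ℝ, 0 ≤ K ∧ ∀ B, M.IsBase B → -K ≤ φ₀ (indicatorPoint B) + w B := by
    have hfin : {B | M.IsBase B}.Finite :=
      M.ground_finite.finite_subsets.subset fun B hB => hB.subset_ground
    obtain ⟨m, hm⟩ := (hfin.image fun B => φ₀ (indicatorPoint B) + w B).bddBelow
    exact ⟨|m|, abs_nonneg m, fun B hB => (neg_abs_le m).trans (hm ⟨B, hB, rfl⟩)⟩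
  have hval : ∀ B, (φ₀ + K • φ₁) (indicatorPoint B) + w B =
      (φ₀ (indicatorPoint B) + w B) + K * φ₁ (indicatorPoint B) := fun B => by
    simp only [LinearMap.add_apply, LinearMap.smul_apply, smul_eq_mul]
    ring
  -- the values on the vertices of the octahedron
  have hpair : ∀ x ∈ ({i, j, k, l} : Finset α), ∀ y ∈ ({i, j, k, l} : Finset α), x ≠ y →
      M.IsBase (insert x (insert y S) : Finset α) →
      (φ₀ + K • φ₁) (indicatorPoint ((insert x (insert y S) : Finset α) : Set α)) +
          w (insert x (insert y S) : Finset α) =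
        f x + f y + W (insert x (insert y S)) - K * S.card := by
    intro x hx y hy hxy hB
    have hxS : x ∉ insert y S := by simp [hxy, hnotS x hx]
    rw [hval, hφ₀ _ hB.subset_ground, hφ₁ _ hB.subset_ground, Finset.sum_insert hxS,
      Finset.sum_insert (hnotS y hy), Finset.sum_insert hxS, Finset.sum_insert (hnotS y hy), hfS,
      hgsum, hgT x hx, hgT y hy, hWb _ hB]
    ring
  have hmi : i ∈ ({i, j, k, l} : Finset α) := by simp
  have hmj : j ∈ ({i, j, k, l} : Finset α) := by simp
  have hmk : k ∈ ({i, j, k, l} : Finset α) := by simp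
  have hml : l ∈ ({i, j, k, l} : Finset α) := by simp
  have hnonneg : ∀ x ∈ ({i, j, k, l} : Finset α), ∀ y ∈ ({i, j, k, l} : Finset α), x ≠ y →
      0 ≤ f x + f y + W (insert x (insert y S)) := by
    have hsymm : ∀ x y, 0 ≤ f x + f y + W (insert x (insert y S)) →
        0 ≤ f y + f x + W (insert y (insert x S)) := fun x y h => by
      rwa [add_comm (f y), Finset.insert_comm]
    have eij : 0 ≤ f i + f j + W (insert i (insert j S)) := by rw [hfi, hfj]; linarith
    have ekl : 0 ≤ f k + f l + W (insert k (insert l S)) := by rw [hfk, hfl]; linarith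
    have eik : 0 ≤ f i + f k + W (insert i (insert k S)) := by rw [hfi, hfk]; linarith
    have ejl : 0 ≤ f j + f l + W (insert j (insert l S)) := by rw [hfj, hfl]; linarith
    have eil : 0 ≤ f i + f l + W (insert i (insert l S)) := by rw [hfi, hfl]; linarith
    have ejk : 0 ≤ f j + f k + W (insert j (insert k S)) := by rw [hfj, hfk]; linarith
    have eji := hsymm _ _ eij
    have elk := hsymm _ _ ekl
    have eki := hsymm _ _ eik
    have elj := hsymm _ _ ejl
    have eli := hsymm _ _ eil
    have ekj := hsymm _ _ ejk
    simp only [Finset.mem_insert, Finset.mem_singleton]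
    rintro x (rfl | rfl | rfl | rfl) y (rfl | rfl | rfl | rfl) hxy <;>
      first | assumption | exact absurd rfl hxy
  have hlower : ∀ B, M.IsBase B →
      -(K * S.card) ≤ (φ₀ + K • φ₁) (indicatorPoint B) + w B := by
    intro B hB
    lift B to Finset α using M.ground_finite.subset hB.subset_ground
    by_cases hoct : S ⊆ B ∧ B \ S ⊆ {i, j, k, l}
    · have hcard : (B \ S).card = 2 := by
        have h := hB.ncard_eq_ncard_of_isBase h₁
        rw [Set.ncard_coe_finset, Set.ncard_coe_finset, Finset.card_insert_of_notMem (by simp [hij, hi]),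
          Finset.card_insert_of_notMem hj] at h
        rw [Finset.card_sdiff_of_subset hoct.1]
        omega
      obtain ⟨x, y, hxy, hBS⟩ := Finset.card_eq_two.1 hcard
      have hx : x ∈ ({i, j, k, l} : Finset α) := hoct.2 (by simp [hBS])
      have hy : y ∈ ({i, j, k, l} : Finset α) := hoct.2 (by simp [hBS])
      obtain rfl : B = insert x (insert y S) := by
        rw [← Finset.sdiff_union_of_subset hoct.1, hBS]
        simp
      rw [hpair x hx y hy hxy hB]
      linarith [hnonneg x hx y hy hxy]
    · have hφ : 1 - (S.card : ℝ) ≤ φ₁ (indicatorPoint (B : Set α)) := by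
        rw [hφ₁ B hB.subset_ground, ← Finset.sum_inter_add_sum_sdiff B S g,
          Finset.sum_congr rfl fun x hx => hgS x (Finset.mem_inter.1 hx).2]
        have hg0 : ∀ x ∈ B \ S, 0 ≤ g x := fun x hx => by
          by_cases hxT : x ∈ ({i, j, k, l} : Finset α)
          · rw [hgT x hxT]
          · rw [hgU x (Finset.mem_sdiff.1 hx).2 hxT]; exact zero_le_one
        simp only [Finset.sum_const, nsmul_eq_mul, mul_neg, mul_one]
        rw [not_and_or] at hoct
        rcases hoct with h | h
        · have hlt : (B ∩ S).card + 1 ≤ S.card := Finset.card_lt_card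
            ⟨Finset.inter_subset_right, fun h' => h fun x hx => (Finset.mem_inter.1 (h' hx)).1⟩
          have hlt' : ((B ∩ S).card : ℝ) + 1 ≤ S.card := by exact_mod_cast hlt
          linarith [Finset.sum_nonneg hg0]
        · obtain ⟨x, hx, hxT⟩ := Finset.not_subset.1 h
          have hle : ((B ∩ S).card : ℝ) ≤ S.card := by
            exact_mod_cast Finset.card_le_card Finset.inter_subset_right
          have := Finset.single_le_sum hg0 hx
          rw [hgU x (Finset.mem_sdiff.1 hx).2 hxT] at this
          linarith
      rw [hval]
      have := hK _ hB
      have := mul_le_mul_of_nonneg_left hφ hKpos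
      linarith
  obtain ⟨N, -, hN⟩ := Matroid.isMatroidSubdivision_iff.1 hw (φ₀ + K • φ₁)
  have hvij := hpair i hmi j hmj hij h₁
  have hvkl := hpair k hmk l hml hkl h₂
  have hN₁ : N.IsBase (insert i (insert j S) : Finset α) := (hN _).1 ⟨h₁, fun C hC => by
    refine le_trans (le_of_eq ?_) (hlower C hC)
    rw [hvij, hfi, hfj]; ring⟩
  have hN₂ : N.IsBase (insert k (insert l S) : Finset α) := (hN _).1 ⟨h₂, fun C hC => by
    refine le_trans (le_of_eq ?_) (hlower C hC)
    rw [hvkl, hfk, hfl]; ring⟩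
  -- Removing `i` from `ij` forces `jk` or `jl` into the cell, but both have positive excess.
  rcases N.exchange_two hi hij hik hil hN₁ hN₂ with h | h
  · obtain ⟨hb, hle⟩ := (hN _).2 h
    have := hle _ h₁
    rw [hvij, hpair j hmj k hmk hjk hb, hfi, hfj, hfk] at this
    linarith
  · obtain ⟨hb, hle⟩ := (hN _).2 h
    have := hle _ h₁
    rw [hvij, hpair j hmj l hml hjl hb, hfi, hfj, hfl] at this
    linarith

open Classical in
/-- A height function inducing a matroid subdivision gives a tropical representation. -/
noncomputable def Matroid.IsMatroidSubdivision.tropicalRep {α : Type*} [DecidableEq α]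
    {M : Matroid α} [M.Finite] {w : Set α → ℝ}
    (hw : M.IsMatroidSubdivision (M.regularSubdivision w)) : M.TropicalRep where
  val I := if M.IsBase (I : Set α) then Real.toNNReal (Real.exp (-w I)) else 0
  support I := by simp [Real.exp_pos]
  plucker S i j k l hi hj hk hl hij hik hil hjk hjl hkl := by
    have hmax : ∀ {i j k l : α}, i ∉ S → j ∉ S → k ∉ S → l ∉ S →
        i ≠ j → i ≠ k → i ≠ l → j ≠ k → j ≠ l → k ≠ l →
        ∀ v : Finset α → ℝ≥0, (v = fun I : Finset α =>
          if M.IsBase (I : Set α) then Real.toNNReal (Real.exp (-w I)) else 0) →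
        v (insert i (insert j S)) * v (insert k (insert l S)) ≤
          max (v (insert i (insert k S)) * v (insert j (insert l S)))
            (v (insert i (insert l S)) * v (insert j (insert k S))) := by
      rintro i j k l hi hj hk hl hij hik hil hjk hjl hkl v rfl
      by_cases h₁ : M.IsBase (insert i (insert j S) : Finset α)
      swap
      · simp only [if_neg h₁, zero_mul, zero_le]
      by_cases h₂ : M.IsBase (insert k (insert l S) : Finset α)
      swap
      · simp only [if_neg h₂, mul_zero, zero_le]
      rw [le_max_iff]
      refine (hw.octahedron hi hj hk hl hij hik hil hjk hjl hkl h₁ h₂).imp ?_ ?_ <;>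
      · rintro ⟨h₃, h₄, hle⟩
        simp only [if_pos h₁, if_pos h₂, if_pos h₃, if_pos h₄,
          ← Real.toNNReal_mul (Real.exp_pos _).le, ← Real.exp_add]
        exact Real.toNNReal_le_toNNReal (Real.exp_le_exp.2 (by linarith))
    have h₁ := hmax hi hj hk hl hij hik hil hjk hjl hkl _ rfl
    have h₂ := hmax hi hk hj hl hik hij hil hjk.symm hkl hjl _ rfl
    have h₃ := hmax hi hl hj hk hil hij hik hjl.symm hkl.symm hjk _ rfl
    rw [Finset.insert_comm k j] at h₂
    rw [Finset.insert_comm l k, Finset.insert_comm l j] at h₃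
    exact mem_tropicalNullset_of_le_max h₁ h₂ h₃

/-- Agreement can be expected at bases only, because the representation forgets the other values of
`w`. The subdivision does not see those either. -/
theorem Matroid.IsMatroidSubdivision.height_tropicalRep {α : Type*} [DecidableEq α]
    {M : Matroid α} [M.Finite] {w : Set α → ℝ}
    (hw : M.IsMatroidSubdivision (M.regularSubdivision w)) {B : Set α} (hB : M.IsBase B) :
    hw.tropicalRep.height B = w B := by
  lift B to Finset α using M.ground_finite.subset hB.subset_ground
  rw [Matroid.TropicalRep.height_coe]
  simp [Matroid.IsMatroidSubdivision.tropicalRep, hB, (Real.exp_pos _).le]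

/-! ### Rigidity and rescaling classes -/

/-- A finite matroid `M` is rigid if and only if the set of rescaling classes of representations
of `M` over the tropical hyperfield has exactly one element, the class of the trivial valuation. -/
theorem propositionB1 {α : Type*} [DecidableEq α] (M : Matroid α) [M.Finite] :
    M.IsRigid ↔
      (Set.univ : Set M.TropicalRescalingClass) = {M.trivialTropicalClass} := by
  have hclass : (Set.univ : Set M.TropicalRescalingClass) = {M.trivialTropicalClass} ↔
      ∀ Δ : M.TropicalRep, M.IsTrivialSubdivision (M.regularSubdivision Δ.height) := by
    simp only [← Matroid.TropicalRep.rescaling_trivial_iff]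
    constructor
    · intro h Δ
      have hΔ : (Quotient.mk (Matroid.TropicalRep.rescalingSetoid M) Δ : M.TropicalRescalingClass) ∈
          ({M.trivialTropicalClass} : Set M.TropicalRescalingClass) := h ▸ Set.mem_univ _
      exact Quotient.exact (Set.mem_singleton_iff.1 hΔ).symm
    · intro h
      refine (Set.eq_univ_of_forall fun c => ?_).symm
      induction c using Quotient.inductionOn with
      | _ Δ => exact (Quotient.sound (h Δ)).symm
  rw [hclass]
  constructor
  · exact fun h Δ => h _ Δ.isMatroidSubdivision
  · intro h w hw
    obtain ⟨φ, m, hm⟩ := Matroid.isTrivialSubdivision_iff.1 (h hw.tropicalRep)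
    exact Matroid.isTrivialSubdivision_iff.2
      ⟨φ, m, fun B hB => by rw [← hw.height_tropicalRep hB, hm B hB]⟩
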